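/- Let $E=(E^0,E^1,r,s)$ be an arbitrary directed graph, with no restriction on the number of vertices or on the number of edges emitted by a vertex. Let $C^*(E)$ be its graph C*-algebra, that is, the universal C*-algebra generated by mutually orthogonal projections $p_v$ ($v\in E^0$) and partial isometries $s_e$ ($e\in E^1$) with mutually orthogonal ranges such that $s_e^*s_e=p_{r(e)}$ and $s_es_e^*\le p_{s(e)}$ for every edge $e$, and $p_v=\sum_{s(e)=v}s_es_e^*$ for every vertex $v$ that emits a finite non-zero number of edges. If $C^*(E)$ is a Zorn ring (every element $a$ is either nilpotent or admits an element $b$ such that $ab$ is a non-zero idempotent), then $E$ satisfies Condition (L): for every simple closed path $e_1\cdots e_n$ ($n\ge 1$, $r(e_i)=s(e_{i+1})$ for $i<n$, $r(e_n)=s(e_1)$, and $s(e_i)\ne s(e_1)$ for $i\ge 2$) there is an edge $e$ such that $s(e)=s(e_i)$ and $e\ne e_i$ for some $i$. -/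

import Mathlib

open scoped ENNReal

universe u v w

/-! ### Directed graphs and Condition (L) -/

/-- A directed graph with vertex set `V` and edge set `E`: every edge `e` has a source `src e` and a
range `rng e`.  Loops, multiple edges, infinite emitters and uncountable sets are all allowed. -/
structure DirectedGraph (V : Type u) (E : Type v) where
  src : E → V
  rng : E → V

namespace DirectedGraph

variable {V : Type u} {E : Type v} (G : DirectedGraph V E)

/-- The finite sequence of edges `μ 0, …, μ n` (of length `n + 1 ≥ 1`) is a simple closed path:
consecutive edges are composable, the last edge ends where the first one starts, and the path does
not pass through its base `src (μ 0)` again. -/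
structure IsSimpleClosedPath {n : ℕ} (μ : Fin (n + 1) → E) : Prop where
  composable : ∀ i : Fin n, G.rng (μ i.castSucc) = G.src (μ i.succ)
  closed : G.rng (μ (Fin.last n)) = G.src (μ 0)
  simple : ∀ i, i ≠ 0 → G.src (μ i) ≠ G.src (μ 0)

/-- The edge `e` is an exit for the path `μ`: it starts where some edge `μ i` of the path starts,
and it is different from `μ i`. -/
def IsExit {n : ℕ} (μ : Fin (n + 1) → E) (e : E) : Prop :=
  ∃ i, G.src e = G.src (μ i) ∧ e ≠ μ i

/-- Condition (L): every simple closed path has an exit. -/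
def ConditionL : Prop :=
  ∀ (n : ℕ) (μ : Fin (n + 1) → E), G.IsSimpleClosedPath μ → ∃ e, G.IsExit μ e

/-! ### Cuntz-Krieger families -/

/-- A Cuntz-Krieger `G`-family in a C⋆-algebra `B`: mutually orthogonal projections `p x` and
partial isometries `s e` with initial projection `s e⋆ s e = p (rng e)`, with range projection
below `p (src e)` and with mutually orthogonal ranges, such that
`p x = ∑_{src e = x} s e s e⋆` whenever `x` emits a finite non-zero number of edges. -/
structure CuntzKriegerFamily (B : Type w) [NonUnitalCStarAlgebra B] where
  p : V → B
  s : E → B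
  isStarProjection_p : ∀ x, IsStarProjection (p x)
  p_mul_p_of_ne : ∀ x y, x ≠ y → p x * p y = 0
  p_src_mul_s : ∀ e, p (G.src e) * s e = s e
  star_s_mul_s : ∀ e, star (s e) * s e = p (G.rng e)
  star_s_mul_s_of_ne : ∀ e f, e ≠ f → star (s e) * s f = 0
  p_eq_sum : ∀ (x : V) (hfin : {e | G.src e = x}.Finite), {e | G.src e = x}.Nonempty →
    p x = ∑ e ∈ hfin.toFinset, s e * star (s e)

variable {G}

theorem CuntzKriegerFamily.norm_p_le_one {B : Type w} [NonUnitalCStarAlgebra B]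
    (F : G.CuntzKriegerFamily B) (x : V) : ‖F.p x‖ ≤ 1 := by
  have h := CStarRing.norm_star_mul_self (x := F.p x)
  rw [(F.isStarProjection_p x).isSelfAdjoint.star_eq,
    (F.isStarProjection_p x).isIdempotentElem.eq] at h
  by_contra! hlt
  nlinarith

theorem CuntzKriegerFamily.norm_s_le_one {B : Type w} [NonUnitalCStarAlgebra B]
    (F : G.CuntzKriegerFamily B) (e : E) : ‖F.s e‖ ≤ 1 := by
  have h := CStarRing.norm_star_mul_self (x := F.s e)
  rw [F.star_s_mul_s] at h
  have := F.norm_p_le_one (G.rng e)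
  by_contra! hlt
  nlinarith

variable (G)

/-! ### The graph C⋆-algebra -/

/-- A C⋆-algebra together with a Cuntz-Krieger `G`-family in it.  The universe is large enough to
contain a copy of every C⋆-algebra that is generated by a Cuntz-Krieger `G`-family: such an algebra
has a dense subset of cardinality at most `κ = max (#V, #E, ℵ₀)`, hence at most `κ ^ ℵ₀` elements. -/
structure CuntzKriegerAlgebra : Type (max u v + 1) where
  carrier : Type (max u v)
  [isCStarAlgebra : NonUnitalCStarAlgebra carrier]
  family : G.CuntzKriegerFamily carrier

attribute [instance] CuntzKriegerAlgebra.isCStarAlgebra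

/-- The C⋆-algebra of bounded sections of the family of all Cuntz-Krieger `G`-families
(their `ℓ^∞` direct product, with the supremum norm). -/
abbrev CuntzKriegerProduct : Type (max u v + 1) :=
  lp (fun i : G.CuntzKriegerAlgebra => i.carrier) ∞

/-- The projection at `x` of all Cuntz-Krieger families simultaneously. -/
def productP (x : V) : G.CuntzKriegerProduct :=
  ⟨fun i => i.family.p x, memℓp_infty ⟨1, by rintro _ ⟨i, rfl⟩; exact i.family.norm_p_le_one x⟩⟩

/-- The partial isometry at `e` of all Cuntz-Krieger families simultaneously. -/
def productS (e : E) : G.CuntzKriegerProduct :=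
  ⟨fun i => i.family.s e, memℓp_infty ⟨1, by rintro _ ⟨i, rfl⟩; exact i.family.norm_s_le_one e⟩⟩

/-- The graph C⋆-algebra `C⋆(G)`, the universal C⋆-algebra generated by a Cuntz-Krieger `G`-family:
the closed `⋆`-subalgebra generated by the family `productP`, `productS`.  Thus the norm of a
`⋆`-polynomial in the generators is the supremum of its norms over all Cuntz-Krieger `G`-families.
It need not have a unit. -/
noncomputable def cstarSubalgebra : NonUnitalStarSubalgebra ℂ G.CuntzKriegerProduct :=
  (NonUnitalStarAlgebra.adjoin ℂ
    (Set.range G.productP ∪ Set.range G.productS)).topologicalClosure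

/-- The graph C⋆-algebra as a type. -/
abbrev CStar : Type (max u v + 1) := G.cstarSubalgebra

noncomputable instance : NonUnitalCStarAlgebra G.CStar :=
  NonUnitalStarSubalgebra.nonUnitalCStarAlgebra G.cstarSubalgebra
    (h_closed := NonUnitalStarSubalgebra.isClosed_topologicalClosure _)

/-- The vertex projections and edge partial isometries of `C⋆(G)`. -/
noncomputable def canonicalFamily : G.CuntzKriegerFamily G.CStar where
  p x := ⟨G.productP x, NonUnitalStarSubalgebra.le_topologicalClosure _
    (NonUnitalStarAlgebra.subset_adjoin ℂ _ (Or.inl ⟨x, rfl⟩))⟩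
  s e := ⟨G.productS e, NonUnitalStarSubalgebra.le_topologicalClosure _
    (NonUnitalStarAlgebra.subset_adjoin ℂ _ (Or.inr ⟨e, rfl⟩))⟩
  isStarProjection_p x :=
    ⟨Subtype.ext <| lp.ext <| funext fun i =>
        (i.family.isStarProjection_p x).isIdempotentElem.eq,
      Subtype.ext <| lp.ext <| funext fun i =>
        (i.family.isStarProjection_p x).isSelfAdjoint.star_eq⟩
  p_mul_p_of_ne x y h := Subtype.ext <| lp.ext <| funext fun i => i.family.p_mul_p_of_ne x y h
  p_src_mul_s e := Subtype.ext <| lp.ext <| funext fun i => i.family.p_src_mul_s e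
  star_s_mul_s e := Subtype.ext <| lp.ext <| funext fun i => i.family.star_s_mul_s e
  star_s_mul_s_of_ne e f h :=
    Subtype.ext <| lp.ext <| funext fun i => i.family.star_s_mul_s_of_ne e f h
  p_eq_sum x hfin hne := Subtype.ext <| lp.ext <| funext fun i => by
    rw [AddSubmonoidClass.coe_finsetSum, lp.coeFn_sum, Finset.sum_apply]
    exact i.family.p_eq_sum x hfin hne

/-- The universal property: every Cuntz-Krieger `G`-family in a C⋆-algebra `B` is the image of the
canonical one under exactly one `⋆`-homomorphism. -/
theorem existsUnique_lift (B : Type (max u v)) [NonUnitalCStarAlgebra B]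
    (F : G.CuntzKriegerFamily B) :
    ∃! φ : G.CStar →⋆ₙₐ[ℂ] B,
      (∀ x, φ (G.canonicalFamily.p x) = F.p x) ∧ ∀ e, φ (G.canonicalFamily.s e) = F.s e := by
  let i : G.CuntzKriegerAlgebra := ⟨B, F⟩
  let ev : G.CuntzKriegerProduct →⋆ₙₐ[ℂ] B :=
    { toFun := fun f => f i
      map_smul' := fun _ _ => rfl
      map_zero' := rfl
      map_add' := fun _ _ => rfl
      map_mul' := fun _ _ => rfl
      map_star' := fun _ => rfl }
  refine ⟨ev.comp (NonUnitalStarSubalgebraClass.subtype G.cstarSubalgebra),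
    ⟨fun _ => rfl, fun _ => rfl⟩, ?_⟩
  rintro φ ⟨hp, hs⟩
  ext ⟨a, ha⟩
  have hcont (χ : G.CStar →⋆ₙₐ[ℂ] B) : Continuous χ :=
    AddMonoidHomClass.continuous_of_bound χ 1
      (by simpa only [one_mul] using NonUnitalStarAlgHom.norm_apply_le χ)
  refine closure_minimal (s := {b : G.CStar | (b : G.CuntzKriegerProduct) ∈
      NonUnitalStarAlgebra.adjoin ℂ (Set.range G.productP ∪ Set.range G.productS)}) ?_
    (isClosed_eq (hcont φ) (hcont
      (ev.comp (NonUnitalStarSubalgebraClass.subtype G.cstarSubalgebra)))) ?_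
  · rintro ⟨b, hb⟩ (hb' : b ∈ NonUnitalStarAlgebra.adjoin ℂ _)
    change φ ⟨b, hb⟩ = b i
    have key : ∀ hb'' : b ∈ G.cstarSubalgebra, φ ⟨b, hb''⟩ = b i := by
      clear hb
      have hle := NonUnitalStarSubalgebra.le_topologicalClosure (NonUnitalStarAlgebra.adjoin ℂ
        (Set.range G.productP ∪ Set.range G.productS))
      induction hb' using NonUnitalStarAlgebra.adjoin_induction with
      | mem x hx =>
        intro _
        rcases hx with ⟨x, rfl⟩ | ⟨e, rfl⟩
        · exact hp x
        · exact hs e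
      | add x y hx hy ihx ihy =>
        intro _
        exact (map_add φ ⟨x, hle hx⟩ ⟨y, hle hy⟩).trans (congrArg₂ _ (ihx _) (ihy _))
      | zero => intro _; exact map_zero φ
      | mul x y hx hy ihx ihy =>
        intro _
        exact (map_mul φ ⟨x, hle hx⟩ ⟨y, hle hy⟩).trans (congrArg₂ _ (ihx _) (ihy _))
      | smul r x hx ihx =>
        intro _
        exact (map_smul φ r ⟨x, hle hx⟩).trans (congrArg _ (ihx _))
      | star x hx ihx =>
        intro _
        exact (map_star φ ⟨x, hle hx⟩).trans (congrArg _ (ihx _))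
    exact key hb
  · rw [closure_subtype]
    refine closure_mono (fun b hb => ?_) ha
    exact ⟨⟨b, NonUnitalStarSubalgebra.le_topologicalClosure _ hb⟩, hb, rfl⟩

end DirectedGraph

/-! ### Zorn rings -/

/-- The power `a ^ (n + 1)` in a ring that need not have a unit. -/
def succPow {R : Type w} [NonUnitalRing R] (a : R) : ℕ → R
  | 0 => a
  | n + 1 => succPow a n * a

/-- A (not necessarily unital) ring is a Zorn ring if for every element `a`, either `a` is nilpotent
or there is an element `b` such that `a * b` is a non-zero idempotent. -/
def IsZornRing (R : Type w) [NonUnitalRing R] : Prop :=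
  ∀ a : R, (∃ n, succPow a n = 0) ∨ ∃ b : R, IsIdempotentElem (a * b) ∧ a * b ≠ 0

/-! A simple closed path without exit determines an infinite path `x` that is periodic and has no
exit. Let `u` be the product of the edge partial isometries over one period. It is normal, with
`u * star u = star u * u = p`, the projection at the base vertex. The algebra is densely spanned by
the products `a * star b` of path isometries, and `p * (a * star b) * p` is `0` or a power of `u` or
`star u`, because `x` is the only path that leaves the base vertex; so the corner at `p` lies in the
C⋆-algebra generated by `u`. Twisting the operators on `ℓ²` of infinite paths by the gauge action
makes `x` an eigenvector of `u` for any prescribed eigenvalue on the unit circle, whence the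
functional calculus identifies the corner with the continuous functions on the circle. There
`u - p` is the function `z - 1`: it is not nilpotent, and as the circle is connected and `z - 1`
vanishes at `1`, none of its multiples is a non-zero idempotent. -/

section ZornRing

variable {A : Type w} [NonUnitalCStarAlgebra A] {u : A}

theorem succPow_cfcₙ {f : ℂ → ℂ} (hf : ContinuousOn f (quasispectrum ℂ u)) (hf0 : f 0 = 0)
    (n : ℕ) : succPow (cfcₙ f u) n = cfcₙ (fun z => f z ^ (n + 1)) u := by
  induction n with
  | zero => simp only [succPow, zero_add, pow_one]
  | succ n ih =>
    simp only [succPow, ih, pow_succ _ (n + 1)]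
    exact (cfcₙ_mul (fun z => f z ^ (n + 1)) f u (hf.pow _) (by simp [hf0])).symm

variable [IsStarNormal u]

theorem exists_cfcₙ_eq_of_mem_elemental {x : A} (hx : x ∈ NonUnitalStarAlgebra.elemental ℂ u) :
    ∃ g : ℂ → ℂ, ContinuousOn g (quasispectrum ℂ u) ∧ g 0 = 0 ∧ cfcₙ g u = x := by
  obtain ⟨g, rfl⟩ : x ∈ Set.range (cfcₙ · u : (ℂ → ℂ) → A) := by
    rwa [range_cfcₙ ℂ (inferInstance : IsStarNormal u)]
  by_cases hg : ContinuousOn g (quasispectrum ℂ u)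
  · by_cases hg0 : g 0 = 0
    · exact ⟨g, hg, hg0, rfl⟩
    · exact ⟨0, continuousOn_const, rfl, by simp [cfcₙ_apply_of_not_map_zero u hg0]⟩
  · exact ⟨0, continuousOn_const, rfl, by simp [cfcₙ_apply_of_not_continuousOn u hg]⟩

theorem norm_eq_one_of_mem_quasispectrum (hu : u * star u * u = u) {z : ℂ}
    (hz : z ∈ quasispectrum ℂ u) (h0 : z ≠ 0) : ‖z‖ = 1 := by
  have hcfc : cfcₙ (fun z : ℂ => z * star z * z) u = cfcₙ (fun z : ℂ => z) u := by
    rw [cfcₙ_mul (fun z : ℂ => z * star z) (fun z : ℂ => z) u,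
      cfcₙ_mul (fun z : ℂ => z) (fun z : ℂ => star z) u, cfcₙ_star, cfcₙ_id' ℂ u, hu]
  have hz' : z * star z * z = z :=
    (cfcₙ_eq_cfcₙ_iff_eqOn (f := fun z : ℂ => z * star z * z) (g := fun z : ℂ => z)).1 hcfc hz
  have hsq : ‖z‖ * ‖z‖ = 1 := by
    rw [← CStarRing.norm_self_mul_star, (mul_eq_right₀ h0).1 hz', norm_one]
  exact (mul_self_eq_one_iff.1 hsq).resolve_right (by linarith [norm_nonneg z])

theorem cfcₙ_eq_zero_of_isIdempotentElem (hu : u * star u * u = u)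
    (hσ : Metric.sphere (0 : ℂ) 1 ⊆ quasispectrum ℂ u) {f : ℂ → ℂ}
    (hf : ContinuousOn f (quasispectrum ℂ u)) (hf0 : f 0 = 0) (hf1 : f 1 = 0)
    (h : IsIdempotentElem (cfcₙ f u)) : cfcₙ f u = 0 := by
  have hidem : Set.EqOn (fun z => f z * f z) f (quasispectrum ℂ u) := by
    refine eqOn_of_cfcₙ_eq_cfcₙ (a := u) ?_ (hf := hf.mul hf) (hf0 := by simp [hf0])
    rw [cfcₙ_mul f f u, h.eq]
  have hmaps : Set.MapsTo f (Metric.sphere 0 1) {0, 1} := fun z hz =>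
    IsIdempotentElem.iff_eq_zero_or_one.1 (hidem (hσ hz))
  have hsphere : ∀ z ∈ Metric.sphere (0 : ℂ) 1, f z = 0 := fun z hz =>
    ((isPreconnected_sphere (by simp [Complex.rank_real_complex]) 0 1).constant_of_mapsTo
      (Set.toFinite _).isDiscrete (hf.mono hσ) hmaps hz (by simp)).trans hf1
  have hzero : Set.EqOn f 0 (quasispectrum ℂ u) := fun z hz => by
    by_cases h0 : z = 0
    · simp only [h0, hf0, Pi.zero_apply]
    · exact hsphere z (by simpa using norm_eq_one_of_mem_quasispectrum hu hz h0)
  rw [cfcₙ_congr hzero]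
  exact cfcₙ_const_zero ℂ u

theorem succPow_cfcₙ_ne_zero {f : ℂ → ℂ} (hf : ContinuousOn f (quasispectrum ℂ u))
    (hf0 : f 0 = 0) {z : ℂ} (hz : z ∈ quasispectrum ℂ u) (hfz : f z ≠ 0) (n : ℕ) :
    succPow (cfcₙ f u) n ≠ 0 := by
  rw [succPow_cfcₙ hf hf0, ← cfcₙ_const_zero ℂ u]
  intro h
  have heq : Set.EqOn (fun z => f z ^ (n + 1)) (fun _ => 0) (quasispectrum ℂ u) :=
    eqOn_of_cfcₙ_eq_cfcₙ h (hf := hf.pow _) (hf0 := by simp [hf0]) (hg0 := rfl)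
  exact pow_ne_zero (n + 1) hfz (heq hz)

theorem not_isZornRing_of_corner_subset_elemental (hu : u * star u * u = u)
    (hσ : Metric.sphere (0 : ℂ) 1 ⊆ quasispectrum ℂ u)
    (hcorner : ∀ x, u * star u * x * (u * star u) ∈ NonUnitalStarAlgebra.elemental ℂ u) :
    ¬ IsZornRing A := by
  intro hA
  let φ : ℂ → ℂ := fun z => z - z * star z
  have hφ : ContinuousOn φ (quasispectrum ℂ u) := by fun_prop
  have hφ0 : φ 0 = 0 := by simp [φ]
  obtain ⟨p, hp⟩ : ∃ p, u * star u = p := ⟨_, rfl⟩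
  have ha : cfcₙ φ u = u - p := by
    rw [cfcₙ_sub (fun z : ℂ => z) (fun z : ℂ => z * star z) u,
      cfcₙ_mul (fun z : ℂ => z) (fun z : ℂ => star z) u, cfcₙ_star, cfcₙ_id' ℂ u, hp]
  have hpu : p * u = u := hp ▸ hu
  have hup : u * p = u := by rw [← hp, ← star_comm_self' u, ← mul_assoc, hu]
  have hpp : p * p = p := by rw [← hp, ← mul_assoc, hu]
  have hap : (u - p) * p = u - p := by rw [sub_mul, hup, hpp]
  have hpa : p * (u - p) = u - p := by rw [mul_sub, hpu, hpp]
  rcases hA (u - p) with ⟨n, hn⟩ | ⟨b, hidem, hne⟩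
  · have hφ' : φ (-1) ≠ 0 := by norm_num [φ]
    exact succPow_cfcₙ_ne_zero hφ hφ0 (hσ (by simp)) hφ' n (ha ▸ hn)
  · obtain ⟨g, hg, hg0, hgb⟩ := exists_cfcₙ_eq_of_mem_elemental (hcorner b)
    have hcfc : cfcₙ (fun z => φ z * g z) u = (u - p) * b * p := by
      rw [cfcₙ_mul φ g u, ha, hgb, hp, ← mul_assoc, ← mul_assoc, hap]
    have hcut : (u - p) * b * p * ((u - p) * b) = (u - p) * b := by
      rw [mul_assoc ((u - p) * b), ← mul_assoc p, hpa, hidem.eq]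
    have hidem' : IsIdempotentElem (cfcₙ (fun z => φ z * g z) u) := by
      rw [IsIdempotentElem, hcfc, ← mul_assoc, hcut]
    have hzero : (u - p) * b * p = 0 := hcfc ▸
      cfcₙ_eq_zero_of_isIdempotentElem hu hσ (hφ.mul hg) (by simp [hg0]) (by simp [φ]) hidem'
    exact hne (by rw [← hcut, hzero, zero_mul])

end ZornRing

/-! ### Partial bijections acting on `ℓ²` -/

section CompPEquiv

open scoped lp

theorem sum_elim_eq_sum_filterMap {X Y M : Type*} [AddCommMonoid M] (t : Finset X)
    (σ : X → Option Y) (hσ : ∀ x x' y, y ∈ σ x → y ∈ σ x' → x = x') (f : Y → M) :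
    ∑ x ∈ t, (σ x).elim 0 f = ∑ y ∈ t.filterMap σ hσ, f y := by
  suffices h : ∀ s : Multiset X,
      (s.map fun x => (σ x).elim 0 f).sum = ((s.filterMap σ).map f).sum from h t.val
  intro s
  induction s using Multiset.induction_on with
  | empty => simp
  | cons x s ih => cases hx : σ x <;> simp [hx, ih]

variable {X : Type*}

theorem sum_norm_elim_rpow_le (σ : X ≃. X) (g : ℓ²(X, ℂ)) (t : Finset X) :
    ∑ x ∈ t, ‖(σ x).elim 0 g‖ ^ (2 : ℝ≥0∞).toReal ≤ ‖g‖ ^ (2 : ℝ≥0∞).toReal := by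
  have helim (x : X) : ‖(σ x).elim 0 g‖ ^ (2 : ℝ≥0∞).toReal =
      (σ x).elim 0 fun y => ‖g y‖ ^ (2 : ℝ≥0∞).toReal := by
    cases σ x <;> simp
  simp only [helim]
  rw [sum_elim_eq_sum_filterMap t σ fun _ _ _ => σ.inj]
  exact lp.sum_rpow_le_norm_rpow (by norm_num) g _

/-- The partial isometry `g ↦ g ∘ σ` of `ℓ²(X)` given by a partial bijection `σ` of `X`, where
`g ∘ σ` is extended by zero outside the domain of `σ`. -/
noncomputable def compPEquiv (σ : X ≃. X) : ℓ²(X, ℂ) →L[ℂ] ℓ²(X, ℂ) :=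
  LinearMap.mkContinuous
    { toFun := fun g => ⟨fun x => (σ x).elim 0 g, memℓp_gen' (sum_norm_elim_rpow_le σ g)⟩
      map_add' := fun f g => lp.ext <| funext fun x => by
        change (σ x).elim 0 (⇑f + ⇑g) = (σ x).elim 0 f + (σ x).elim 0 g
        cases σ x <;> simp
      map_smul' := fun c g => lp.ext <| funext fun x => by
        change (σ x).elim 0 (c • ⇑g) = c • (σ x).elim 0 g
        cases σ x <;> simp }
    1 fun g => by
      rw [one_mul]
      exact lp.norm_le_of_forall_sum_le (by norm_num) (norm_nonneg _) (sum_norm_elim_rpow_le σ g)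

theorem compPEquiv_apply (σ : X ≃. X) (g : ℓ²(X, ℂ)) (x : X) :
    compPEquiv σ g x = (σ x).elim 0 g := rfl

theorem compPEquiv_bot : compPEquiv (⊥ : X ≃. X) = 0 := by
  ext g x
  rfl

theorem compPEquiv_trans (σ τ : X ≃. X) :
    compPEquiv (σ.trans τ) = compPEquiv σ * compPEquiv τ := by
  ext g x
  change (σ.trans τ x).elim 0 g = (σ x).elim 0 fun y => (τ y).elim 0 g
  cases h : σ x <;> simp [PEquiv.trans, h]

theorem compPEquiv_ofSet_apply (s : Set X) [DecidablePred (· ∈ s)] (g : ℓ²(X, ℂ)) (x : X) :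
    compPEquiv (PEquiv.ofSet s) g x = if x ∈ s then g x else 0 := by
  rw [compPEquiv_apply]
  change (if x ∈ s then some x else none).elim 0 g = _
  split_ifs <;> rfl

theorem compPEquiv_single [DecidableEq X] {σ : X ≃. X} {x y : X} (h : σ x = some y) (c : ℂ) :
    compPEquiv σ (lp.single 2 y c) = lp.single 2 x c := by
  ext x'
  rw [compPEquiv_apply, lp.single_apply]
  rcases eq_or_ne x' x with rfl | hx
  · simp [h]
  · rw [Pi.single_eq_of_ne hx]
    cases h' : σ x' with
    | none => rfl
    | some y' =>
      have hy : y' ≠ y := by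
        rintro rfl
        exact hx (σ.inj h' h)
      simp [hy]

theorem compPEquiv_single_of_symm_eq_none [DecidableEq X] {σ : X ≃. X} {y : X}
    (h : σ.symm y = none) (c : ℂ) : compPEquiv σ (lp.single 2 y c) = 0 := by
  ext x
  rw [compPEquiv_apply]
  cases h' : σ x with
  | none => rfl
  | some y' =>
    have hy : y' ≠ y := by
      rintro rfl
      simp [σ.eq_some_iff.2 h'] at h
    simp [hy]

theorem star_compPEquiv (σ : X ≃. X) : star (compPEquiv σ) = compPEquiv σ.symm := by
  classical
  ext g y
  have hinner : star (compPEquiv σ) g y = inner ℂ (compPEquiv σ (lp.single 2 y 1)) g := by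
    rw [← ContinuousLinearMap.adjoint_inner_right, lp.inner_single_left]
    simp [ContinuousLinearMap.star_eq_adjoint]
  rw [hinner, compPEquiv_apply]
  cases hy : σ.symm y with
  | none => simp [compPEquiv_single_of_symm_eq_none hy]
  | some x => simp [compPEquiv_single (σ.eq_some_iff.1 hy), lp.inner_single_left]

theorem isStarProjection_compPEquiv_ofSet (s : Set X) [DecidablePred (· ∈ s)] :
    IsStarProjection (compPEquiv (PEquiv.ofSet s)) where
  isIdempotentElem := by
    ext g x
    change compPEquiv _ (compPEquiv _ g) x = _
    simp only [compPEquiv_ofSet_apply]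
    split_ifs <;> rfl
  isSelfAdjoint := by
    rw [IsSelfAdjoint, star_compPEquiv, PEquiv.ofSet_symm]

end CompPEquiv

theorem exists_circle_pow_eq {N : ℕ} (hN : 0 < N) {w : ℂ} (hw : w ∈ Metric.sphere 0 1) :
    ∃ z : Circle, (z : ℂ) ^ N = w := by
  obtain ⟨z, rfl⟩ := IsAlgClosed.exists_pow_nat_eq w hN
  rw [mem_sphere_zero_iff_norm, norm_pow, pow_eq_one_iff_of_nonneg (norm_nonneg z) hN.ne'] at hw
  exact ⟨⟨z, mem_sphere_zero_iff_norm.2 hw⟩, rfl⟩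

theorem mem_spectrum_of_apply_eq_smul {H : Type*} [NormedAddCommGroup H] [NormedSpace ℂ H]
    {T : H →L[ℂ] H} {v : H} {c : ℂ} (hv : v ≠ 0) (h : T v = c • v) : c ∈ spectrum ℂ T := by
  intro hunit
  have hinj := ((Module.End.isUnit_iff _).1
    (hunit.map ContinuousLinearMap.toLinearMapRingHom)).injective
  refine hv (hinj ?_)
  rw [map_zero]
  change (c • v) - T v = 0
  rw [h, sub_self]

/-! ### Infinite paths -/

namespace DirectedGraph

variable {V : Type u} {E : Type v}

/-- The infinite paths of `G`, on which the Cuntz-Krieger family `pathFamily` acts. -/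
@[ext]
structure InfinitePath (G : DirectedGraph V E) : Type (max u v) where
  edge : ℕ → E
  composable : ∀ k, G.rng (edge k) = G.src (edge (k + 1))

variable {G : DirectedGraph V E}

namespace InfinitePath

/-- The vertices that an infinite path visits, starting with its source `x.vertex 0`. -/
def vertex (x : G.InfinitePath) (k : ℕ) : V := G.src (x.edge k)

/-- The infinite path without its first edge: the one-sided shift on the space of paths. -/
def tail (x : G.InfinitePath) : G.InfinitePath where
  edge k := x.edge (k + 1)
  composable k := x.composable (k + 1)

/-- The infinite path with one more edge in front. -/
def cons (e : E) (x : G.InfinitePath) (h : G.rng e = x.vertex 0) : G.InfinitePath where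
  edge k := Nat.casesOn k e x.edge
  composable
    | 0 => h
    | k + 1 => x.composable k

theorem cons_tail (x : G.InfinitePath) : cons (x.edge 0) x.tail (x.composable 0) = x := by
  ext k
  cases k <;> rfl

theorem edge_iterate_tail (x : G.InfinitePath) (k i : ℕ) :
    (tail^[k] x).edge i = x.edge (i + k) := by
  induction k generalizing i with
  | zero => rfl
  | succ k ih =>
    rw [Function.iterate_succ_apply']
    exact (ih (i + 1)).trans (congrArg x.edge (by ring))

open Classical in
/-- The partial bijection that removes the first edge of an infinite path if this edge is `e`. -/
noncomputable def uncons (e : E) : G.InfinitePath ≃. G.InfinitePath where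
  toFun x := if x.edge 0 = e then some (x.tail) else none
  invFun x := if h : G.rng e = x.vertex 0 then some (cons e x h) else none
  inv x y := by
    constructor
    · intro hy
      split_ifs at hy with h
      cases hy
      exact (if_pos rfl).trans (congrArg some (rfl : (cons e y h).tail = y))
    · intro hx
      split_ifs at hx with h
      cases hx
      subst h
      exact (dif_pos (x.composable 0)).trans (congrArg some x.cons_tail)

theorem uncons_eq_some_iff {e : E} {x y : G.InfinitePath} :
    uncons e x = some y ↔ x.edge 0 = e ∧ x.tail = y := by
  classical
  change (if x.edge 0 = e then some (x.tail) else none) = some y ↔ _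
  split_ifs with h <;> simp [h]

open Classical in
theorem uncons_trans_symm (e : E) : (uncons e).trans (uncons e).symm =
    PEquiv.ofSet {x : G.InfinitePath | x.edge 0 = e} := by
  rw [PEquiv.self_trans_symm]
  congr 1
  ext x
  simp [Option.isSome_iff_exists, uncons_eq_some_iff]

open Classical in
theorem uncons_symm_trans (e : E) : (uncons e).symm.trans (uncons e) =
    PEquiv.ofSet {x : G.InfinitePath | x.vertex 0 = G.rng e} := by
  rw [PEquiv.symm_trans_self]
  congr 1
  ext x
  simp only [Set.mem_ofPred_eq, Option.isSome_iff_exists, PEquiv.eq_some_iff, uncons_eq_some_iff]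
  constructor
  · rintro ⟨y, rfl, rfl⟩
    exact (y.composable 0).symm
  · intro h
    exact ⟨cons e x h.symm, rfl, rfl⟩

theorem uncons_symm_trans_of_ne {e f : E} (h : e ≠ f) : (uncons e).symm.trans (uncons f) =
    (⊥ : G.InfinitePath ≃. G.InfinitePath) := by
  ext1 x
  rw [PEquiv.bot_apply, PEquiv.trans_eq_none]
  rintro y z
  by_contra! hyz
  obtain ⟨⟨rfl, -⟩, rfl, -⟩ := And.imp uncons_eq_some_iff.1 uncons_eq_some_iff.1
    ⟨(PEquiv.eq_some_iff _).1 hyz.1, hyz.2⟩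
  exact h rfl

theorem vertex_succ (x : G.InfinitePath) (k : ℕ) : x.vertex (k + 1) = G.rng (x.edge k) :=
  (x.composable k).symm

/-- An infinite path of a directed graph has no exit if it never visits a vertex that emits a second
edge. -/
def IsExitless (x : G.InfinitePath) : Prop :=
  ∀ k e, G.src e = x.vertex k → e = x.edge k

variable {x : G.InfinitePath}

theorem vertex_eq_of_isPeriodicPt {N : ℕ} (hN : Function.IsPeriodicPt tail N x) :
    x.vertex N = x.vertex 0 := by
  conv_rhs => rw [← hN.eq]
  rw [vertex, vertex, edge_iterate_tail, zero_add]

theorem edge_add_of_isPeriodicPt {N : ℕ} (hN : Function.IsPeriodicPt tail N x) (k : ℕ) :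
    x.edge (k + N) = x.edge k := by
  rw [← edge_iterate_tail, hN.eq]

theorem IsExitless.iterate_tail_eq (hx : x.IsExitless) {i j : ℕ} (h : x.vertex i = x.vertex j) :
    tail^[i] x = tail^[j] x := by
  have hvertex (k : ℕ) : x.vertex (k + i) = x.vertex (k + j) := by
    induction k with
    | zero => simpa only [zero_add] using h
    | succ k ih =>
      rw [add_right_comm k 1 i, add_right_comm k 1 j, vertex_succ, vertex_succ, hx _ _ ih]
  ext k
  rw [edge_iterate_tail, edge_iterate_tail]
  exact hx _ _ (hvertex k)

end InfinitePath

open InfinitePath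

/-! ### The corner at an exitless cycle -/

namespace CuntzKriegerFamily

variable {A : Type w} [NonUnitalCStarAlgebra A] (F : G.CuntzKriegerFamily A)

theorem p_mul_self (a : V) : F.p a * F.p a = F.p a := (F.isStarProjection_p a).isIdempotentElem.eq

theorem star_p (a : V) : star (F.p a) = F.p a := (F.isStarProjection_p a).isSelfAdjoint.star_eq

theorem p_mul_s_of_ne {a : V} {e : E} (h : a ≠ G.src e) : F.p a * F.s e = 0 := by
  rw [← F.p_src_mul_s, ← mul_assoc, F.p_mul_p_of_ne _ _ h, zero_mul]

theorem s_mul_p_rng (e : E) : F.s e * F.p (G.rng e) = F.s e := by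
  rw [← sub_eq_zero, ← CStarRing.star_mul_self_eq_zero_iff]
  have hstar : star (F.s e) * (F.s e * F.p (G.rng e) - F.s e) = 0 := by
    rw [mul_sub, ← mul_assoc, F.star_s_mul_s, F.p_mul_self, sub_self]
  rw [star_sub, star_mul, sub_mul, mul_assoc, hstar, mul_zero, sub_zero]

theorem s_mul_star_s {e : E} (h : ∀ f, G.src f = G.src e → f = e) :
    F.s e * star (F.s e) = F.p (G.src e) := by
  have hs : {f | G.src f = G.src e} = {e} := Set.eq_singleton_iff_unique_mem.2 ⟨rfl, h⟩
  have hfin : {f | G.src f = G.src e}.Finite := hs ▸ Set.finite_singleton e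
  have hfin_eq : hfin.toFinset = {e} := by simp [hs]
  rw [F.p_eq_sum _ hfin ⟨e, rfl⟩, hfin_eq, Finset.sum_singleton]

/-- The product `p (x.vertex 0) * s (x.edge 0) * ⋯ * s (x.edge (k - 1))`, the partial isometry of
the initial segment of length `k` of the path `x`. The leading projection accounts for `k = 0`. -/
def pathProd (x : G.InfinitePath) : ℕ → A
  | 0 => F.p (x.vertex 0)
  | k + 1 => pathProd x k * F.s (x.edge k)

theorem pathProd_succ (x : G.InfinitePath) (k : ℕ) :
    F.pathProd x (k + 1) = F.pathProd x k * F.s (x.edge k) := rfl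

theorem pathProd_mul_p (x : G.InfinitePath) (k : ℕ) :
    F.pathProd x k * F.p (x.vertex k) = F.pathProd x k := by
  cases k with
  | zero => exact F.p_mul_self _
  | succ k => rw [vertex_succ, pathProd_succ, mul_assoc, F.s_mul_p_rng]

theorem pathProd_mul_p_of_ne {x : G.InfinitePath} {k : ℕ} {a : V} (h : x.vertex k ≠ a) :
    F.pathProd x k * F.p a = 0 := by
  rw [← F.pathProd_mul_p, mul_assoc, F.p_mul_p_of_ne _ _ h, mul_zero]

theorem star_pathProd_mul_self (x : G.InfinitePath) (k : ℕ) :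
    star (F.pathProd x k) * F.pathProd x k = F.p (x.vertex k) := by
  induction k with
  | zero => rw [pathProd, F.star_p, F.p_mul_self]
  | succ k ih =>
    rw [pathProd_succ, star_mul, mul_assoc, ← mul_assoc (star (F.pathProd x k)), ih, vertex,
      F.p_src_mul_s, F.star_s_mul_s, vertex_succ]

theorem pathProd_mul_star_mul_self (x : G.InfinitePath) (k : ℕ) :
    F.pathProd x k * star (F.pathProd x k) * F.pathProd x k = F.pathProd x k := by
  rw [mul_assoc, F.star_pathProd_mul_self, F.pathProd_mul_p]

theorem pathProd_mul_star_of_ne {x : G.InfinitePath} {i j : ℕ} (h : x.vertex i ≠ x.vertex j) :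
    F.pathProd x i * star (F.pathProd x j) = 0 := by
  rw [← F.pathProd_mul_p x j, star_mul, F.star_p, ← mul_assoc, F.pathProd_mul_p_of_ne h, zero_mul]

theorem pathProd_add {x : G.InfinitePath} {N : ℕ} (hN : Function.IsPeriodicPt tail N x) (k : ℕ) :
    F.pathProd x (k + N) = F.pathProd x N * F.pathProd x k := by
  induction k with
  | zero => rw [zero_add, pathProd, ← vertex_eq_of_isPeriodicPt hN, F.pathProd_mul_p]
  | succ k ih =>
    rw [add_right_comm, pathProd_succ, edge_add_of_isPeriodicPt hN, ih, pathProd_succ, mul_assoc]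

section Exitless

variable {x : G.InfinitePath} (hx : x.IsExitless)

include hx

theorem pathProd_mul_star_self (k : ℕ) :
    F.pathProd x k * star (F.pathProd x k) = F.p (x.vertex 0) := by
  induction k with
  | zero => rw [pathProd, F.star_p, F.p_mul_self]
  | succ k ih =>
    rw [pathProd_succ, star_mul, mul_assoc, ← mul_assoc (F.s _), F.s_mul_star_s (hx k), ← mul_assoc]
    exact (congrArg (· * _) (F.pathProd_mul_p x k)).trans ih

theorem pathProd_mul_s_of_ne {k : ℕ} {e : E} (h : e ≠ x.edge k) : F.pathProd x k * F.s e = 0 := by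
  rw [← F.p_src_mul_s, ← mul_assoc, F.pathProd_mul_p_of_ne fun h' => h (hx k e h'.symm), zero_mul]

theorem isStarNormal_pathProd {N : ℕ} (hN : Function.IsPeriodicPt tail N x) :
    IsStarNormal (F.pathProd x N) where
  star_comm_self := by
    rw [Commute, SemiconjBy, F.star_pathProd_mul_self, F.pathProd_mul_star_self hx,
      vertex_eq_of_isPeriodicPt hN]

end Exitless

/-- The products of vertex projections and edge partial isometries, i.e. the partial isometries of
the finite paths, together with `0`. -/
def pathProducts : Subsemigroup A :=
  Subsemigroup.closure (insert 0 (Set.range F.p ∪ Set.range F.s))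

/-- The products `x * star y` of path products, which span a dense subspace of the algebra that a
Cuntz-Krieger family generates. -/
def monomials : Set A :=
  Set.image2 (fun x y => x * star y) F.pathProducts F.pathProducts

/-- A Cuntz-Krieger family generates `A` as a C⋆-algebra. -/
def Generates : Prop :=
  Dense (NonUnitalStarAlgebra.adjoin ℂ (Set.range F.p ∪ Set.range F.s) : Set A)

theorem zero_mem_pathProducts : 0 ∈ F.pathProducts :=
  Subsemigroup.subset_closure (Set.mem_insert _ _)

theorem p_mem_pathProducts (a : V) : F.p a ∈ F.pathProducts :=
  Subsemigroup.subset_closure (Or.inr (Or.inl ⟨a, rfl⟩))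

theorem s_mem_pathProducts (e : E) : F.s e ∈ F.pathProducts :=
  Subsemigroup.subset_closure (Or.inr (Or.inr ⟨e, rfl⟩))

theorem star_s_mul_of_mem_pathProducts (e : E) {y : A} (hy : y ∈ F.pathProducts) :
    star (F.s e) * y ∈ F.pathProducts ∨ star (F.s e) * y = star (F.s e) := by
  induction hy using Subsemigroup.closure_induction with
  | mem y hy =>
    rcases hy with rfl | ⟨a, rfl⟩ | ⟨f, rfl⟩
    · exact .inl (by simpa only [mul_zero] using F.zero_mem_pathProducts)
    · rcases eq_or_ne a (G.src e) with rfl | ha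
      · right
        rw [← F.star_p, ← star_mul, F.p_src_mul_s]
      · left
        rw [← F.star_p, ← star_mul, F.p_mul_s_of_ne ha, star_zero]
        exact F.zero_mem_pathProducts
    · left
      rcases eq_or_ne e f with rfl | hef
      · exact F.star_s_mul_s e ▸ F.p_mem_pathProducts _
      · exact F.star_s_mul_s_of_ne e f hef ▸ F.zero_mem_pathProducts
  | mul y z _ hz ihy ihz =>
    rw [← mul_assoc]
    rcases ihy with hmem | heq
    · exact .inl (mul_mem hmem hz)
    · rwa [heq]

theorem mul_mem_monomials {m c : A} (hm : m ∈ F.monomials)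
    (hc : c ∈ Set.range F.p ∪ Set.range F.s ∪ star (Set.range F.p ∪ Set.range F.s)) :
    m * c ∈ F.monomials := by
  obtain ⟨x, hx, y, hy, rfl⟩ := hm
  have hstar {d : A} (hd : d ∈ F.pathProducts) : x * star y * star d ∈ F.monomials :=
    ⟨x, hx, d * y, mul_mem hd hy, by simp only [star_mul, mul_assoc]⟩
  rcases hc with (⟨a, rfl⟩ | ⟨e, rfl⟩) | ⟨a, ha⟩ | ⟨e, he⟩
  · exact F.star_p a ▸ hstar (F.p_mem_pathProducts a)
  · have hadj : x * star y * F.s e = x * star (star (F.s e) * y) := by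
      rw [star_mul, star_star, mul_assoc]
    rcases F.star_s_mul_of_mem_pathProducts e hy with hmem | heq
    · exact ⟨x, hx, _, hmem, hadj.symm⟩
    · refine ⟨x * F.s e, mul_mem hx (F.s_mem_pathProducts e), _, F.p_mem_pathProducts (G.rng e), ?_⟩
      change x * F.s e * star (F.p _) = _
      rw [hadj, heq, F.star_p, mul_assoc, F.s_mul_p_rng, star_star]
  · exact star_eq_iff_star_eq.1 ha.symm ▸ hstar (F.p_mem_pathProducts a)
  · exact star_eq_iff_star_eq.1 he.symm ▸ hstar (F.s_mem_pathProducts e)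

theorem generator_mem_monomials {c : A}
    (hc : c ∈ Set.range F.p ∪ Set.range F.s ∪ star (Set.range F.p ∪ Set.range F.s)) :
    c ∈ F.monomials := by
  have hp (a : V) : F.p a ∈ F.monomials :=
    ⟨_, F.p_mem_pathProducts a, _, F.p_mem_pathProducts a, by simp only [F.star_p, F.p_mul_self]⟩
  rcases hc with (⟨a, rfl⟩ | ⟨e, rfl⟩) | ⟨a, ha⟩ | ⟨e, he⟩
  · exact hp a
  · exact F.p_src_mul_s e ▸ F.mul_mem_monomials (hp _) (.inl (.inr ⟨e, rfl⟩))
  · exact star_eq_iff_star_eq.1 ha.symm ▸ (F.star_p a).symm ▸ hp a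
  · refine ⟨_, F.p_mem_pathProducts (G.rng e), _, F.s_mem_pathProducts e, ?_⟩
    change F.p _ * star (F.s e) = c
    rw [← F.star_p, ← star_mul, F.s_mul_p_rng, he, star_star]

theorem adjoin_le_span_monomials :
    (NonUnitalStarAlgebra.adjoin ℂ (Set.range F.p ∪ Set.range F.s)).toSubmodule ≤
      Submodule.span ℂ F.monomials := by
  rw [NonUnitalStarAlgebra.adjoin_eq_span]
  refine Submodule.span_mono fun c hc => ?_
  suffices h : c ∈ F.monomials ∧ ∀ m ∈ F.monomials, m * c ∈ F.monomials from h.1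
  induction hc using Subsemigroup.closure_induction with
  | mem c hc => exact ⟨F.generator_mem_monomials hc, fun m hm => F.mul_mem_monomials hm hc⟩
  | mul c d _ _ ihc ihd =>
    refine ⟨ihd.2 c ihc.1, fun m hm => ?_⟩
    rw [← mul_assoc]
    exact ihd.2 _ (ihc.2 m hm)

section Exitless

variable {x : G.InfinitePath} (hx : x.IsExitless)

include hx

theorem pathProd_mul_of_mem_pathProducts (k : ℕ) {y : A} (hy : y ∈ F.pathProducts) :
    F.pathProd x k * y = 0 ∨ ∃ j, F.pathProd x k * y = F.pathProd x j := by
  induction hy using Subsemigroup.closure_induction generalizing k with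
  | mem y hy =>
    rcases hy with rfl | ⟨a, rfl⟩ | ⟨e, rfl⟩
    · exact .inl (mul_zero _)
    · rcases eq_or_ne (x.vertex k) a with rfl | ha
      · exact .inr ⟨k, F.pathProd_mul_p x k⟩
      · exact .inl (F.pathProd_mul_p_of_ne ha)
    · rcases eq_or_ne e (x.edge k) with rfl | he
      · exact .inr ⟨k + 1, rfl⟩
      · exact .inl (F.pathProd_mul_s_of_ne hx he)
  | mul y z _ _ ihy ihz =>
    rw [← mul_assoc]
    rcases ihy k with h | ⟨j, hj⟩
    · exact .inl (by rw [h, zero_mul])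
    · exact hj ▸ ihz j

theorem pathProd_mul_star_mem_elemental (hper : x ∈ Function.periodicPts tail) (i j : ℕ) :
    F.pathProd x i * star (F.pathProd x j) ∈
      NonUnitalStarAlgebra.elemental ℂ (F.pathProd x (Function.minimalPeriod tail x)) := by
  set N := Function.minimalPeriod tail x
  have hpos : 0 < N := Function.minimalPeriod_pos_of_mem_periodicPts hper
  have hperN : Function.IsPeriodicPt tail N x := Function.isPeriodicPt_minimalPeriod tail x
  have hu := NonUnitalStarAlgebra.elemental.self_mem ℂ (F.pathProd x N)
  induction i using Nat.strong_induction_on generalizing j with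
  | _ i ihi =>
  rcases le_or_gt N i with hi | hi
  · obtain ⟨k, rfl⟩ := Nat.exists_eq_add_of_le' hi
    rw [F.pathProd_add hperN, mul_assoc]
    exact mul_mem hu (ihi k (by omega) j)
  · induction j using Nat.strong_induction_on with
    | _ j ihj =>
    rcases le_or_gt N j with hj | hj
    · obtain ⟨k, rfl⟩ := Nat.exists_eq_add_of_le' hj
      rw [F.pathProd_add hperN, star_mul, ← mul_assoc]
      exact mul_mem (ihj k (by omega)) (star_mem hu)
    · by_cases hij : x.vertex i = x.vertex j
      · obtain rfl := (Function.iterate_eq_iterate_iff_of_lt_minimalPeriod hi hj).1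
          (hx.iterate_tail_eq hij)
        rw [F.pathProd_mul_star_self hx, ← F.pathProd_mul_star_self hx N]
        exact mul_mem hu (star_mem hu)
      · rw [F.pathProd_mul_star_of_ne hij]
        exact zero_mem _

theorem corner_mem_elemental (hF : F.Generates) (hper : x ∈ Function.periodicPts tail) (a : A) :
    F.p (x.vertex 0) * a * F.p (x.vertex 0) ∈
      NonUnitalStarAlgebra.elemental ℂ (F.pathProd x (Function.minimalPeriod tail x)) := by
  have hclosed := (NonUnitalStarAlgebra.elemental.isClosed ℂ
    (F.pathProd x (Function.minimalPeriod tail x))).preimage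
      (f := fun a => F.p (x.vertex 0) * a * F.p (x.vertex 0)) (by fun_prop)
  refine closure_minimal (fun b hb => ?_) hclosed (hF a)
  rw [Set.mem_preimage, SetLike.mem_coe]
  have hspan := F.adjoin_le_span_monomials hb
  clear hb
  induction hspan using Submodule.span_induction with
  | mem b hb =>
    obtain ⟨y, hy, z, hz, rfl⟩ := hb
    have hsplit : F.p (x.vertex 0) * (y * star z) * F.p (x.vertex 0) =
        F.pathProd x 0 * y * star (F.pathProd x 0 * z) := by
      simp only [pathProd, star_mul, F.star_p, mul_assoc]
    rw [hsplit]
    rcases F.pathProd_mul_of_mem_pathProducts hx 0 hy with hy' | ⟨i, hi⟩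
    · simp [hy']
    rcases F.pathProd_mul_of_mem_pathProducts hx 0 hz with hz' | ⟨j, hj⟩
    · simp [hz']
    · rw [hi, hj]
      exact F.pathProd_mul_star_mem_elemental hx hper i j
  | zero => simp
  | add b c _ _ ihb ihc => simpa only [mul_add, add_mul] using add_mem ihb ihc
  | smul r b _ ihb => simpa only [mul_smul_comm, smul_mul_assoc] using SMulMemClass.smul_mem r ihb

end Exitless

/-- The gauge action of the circle on Cuntz-Krieger families: `z` multiplies the edge partial
isometries and fixes the vertex projections. -/
def rotate (z : Circle) : G.CuntzKriegerFamily A where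
  p := F.p
  s e := (z : ℂ) • F.s e
  isStarProjection_p := F.isStarProjection_p
  p_mul_p_of_ne := F.p_mul_p_of_ne
  p_src_mul_s e := by rw [mul_smul_comm, F.p_src_mul_s]
  star_s_mul_s e := by
    rw [star_smul, smul_mul_smul_comm, F.star_s_mul_s, Complex.star_def, Complex.conj_mul',
      Circle.norm_coe, Complex.ofReal_one, one_pow, one_smul]
  star_s_mul_s_of_ne e f h := by
    rw [star_smul, smul_mul_smul_comm, F.star_s_mul_s_of_ne e f h, smul_zero]
  p_eq_sum a hfin hne := by
    simp only [star_smul, smul_mul_smul_comm, Complex.star_def, Complex.mul_conj', Circle.norm_coe,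
      Complex.ofReal_one, one_pow, one_smul]
    exact F.p_eq_sum a hfin hne

theorem rotate_pathProd (z : Circle) (x : G.InfinitePath) (k : ℕ) :
    (F.rotate z).pathProd x k = (z : ℂ) ^ k • F.pathProd x k := by
  induction k with
  | zero => rw [pow_zero, one_smul, pathProd, pathProd, rotate]
  | succ k ih => rw [pathProd_succ, ih, rotate, smul_mul_smul_comm, ← pow_succ, ← pathProd_succ]

end CuntzKriegerFamily

variable (G) in
theorem canonicalFamily_generates : G.canonicalFamily.Generates := by
  refine Subtype.dense_iff.2 ?_
  change _ ⊆ closure ((NonUnitalStarAlgebra.adjoin ℂ _).map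
    (NonUnitalStarSubalgebraClass.subtype G.cstarSubalgebra) : Set G.CuntzKriegerProduct)
  rw [NonUnitalStarAlgHom.map_adjoin, Set.image_union, ← Set.range_comp, ← Set.range_comp]
  exact subset_rfl

/-! ### The spectrum of a cycle -/

variable (G) in
open Classical lp in
/-- The Cuntz-Krieger family of operators on `ℓ²` of the infinite paths of `G`, with `p a` the
projection onto the paths starting at `a`, and `s e` the operator that puts `e` in front of a
path. -/
noncomputable def pathFamily :
    G.CuntzKriegerFamily (ℓ²(G.InfinitePath, ℂ) →L[ℂ] ℓ²(G.InfinitePath, ℂ)) where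
  p a := compPEquiv (PEquiv.ofSet {x | x.vertex 0 = a})
  s e := compPEquiv (uncons e)
  isStarProjection_p a := isStarProjection_compPEquiv_ofSet _
  p_mul_p_of_ne a b hab := by
    ext g x
    change compPEquiv _ (compPEquiv _ g) x = 0
    simp only [compPEquiv_ofSet_apply, Set.mem_ofPred_eq]
    split_ifs with ha hb
    · exact absurd (ha.symm.trans hb) hab
    · rfl
    · rfl
  p_src_mul_s e := by
    ext g x
    change compPEquiv _ (compPEquiv _ g) x = _
    have hnone (hx : x.vertex 0 ≠ G.src e) : uncons e x = none :=
      Option.eq_none_iff_forall_ne_some.2 fun y hy =>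
        hx (congrArg G.src (uncons_eq_some_iff.1 hy).1)
    rw [compPEquiv_ofSet_apply, compPEquiv_apply, ite_eq_left_iff]
    intro hx
    rw [hnone hx]
    rfl
  star_s_mul_s e := by rw [star_compPEquiv, ← compPEquiv_trans, uncons_symm_trans]
  star_s_mul_s_of_ne e f hef := by
    rw [star_compPEquiv, ← compPEquiv_trans, uncons_symm_trans_of_ne hef, compPEquiv_bot]
  p_eq_sum a hfin _ := by
    simp only [star_compPEquiv, ← compPEquiv_trans, uncons_trans_symm]
    ext g x
    rw [compPEquiv_ofSet_apply, _root_.sum_apply, lp.coeFn_sum, Finset.sum_apply]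
    simp only [compPEquiv_ofSet_apply, Set.mem_ofPred_eq, Finset.sum_ite_eq,
      Set.Finite.mem_toFinset]
    rfl

open Classical in
theorem pathFamily_pathProd_single (x : G.InfinitePath) (k : ℕ) (c : ℂ) :
    G.pathFamily.pathProd x k (lp.single 2 (tail^[k] x) c) = lp.single 2 x c := by
  induction k with
  | zero => exact compPEquiv_single (if_pos rfl) c
  | succ k ih =>
    have huncons : uncons (x.edge k) (tail^[k] x) = some (tail^[k + 1] x) := by
      rw [uncons_eq_some_iff, edge_iterate_tail, zero_add, Function.iterate_succ_apply']
      exact ⟨rfl, rfl⟩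
    rw [CuntzKriegerFamily.pathProd_succ, mul_apply_eq_comp, ← ih]
    exact congrArg _ (compPEquiv_single huncons c)

theorem exists_starAlgHom_apply_canonicalFamily_pathProd {B : Type (max u v)}
    [NonUnitalCStarAlgebra B] (F : G.CuntzKriegerFamily B) :
    ∃ φ : G.CStar →⋆ₙₐ[ℂ] B, ∀ x k, φ (G.canonicalFamily.pathProd x k) = F.pathProd x k := by
  obtain ⟨φ, ⟨hp, hs⟩, -⟩ := G.existsUnique_lift B F
  refine ⟨φ, fun x k => ?_⟩
  induction k with
  | zero => exact hp _
  | succ k ih => exact (map_mul φ _ _).trans (congrArg₂ _ ih (hs _))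

theorem sphere_subset_quasispectrum_canonicalFamily_pathProd {x : G.InfinitePath} {N : ℕ}
    (hpos : 0 < N) (hN : Function.IsPeriodicPt tail N x) :
    Metric.sphere (0 : ℂ) 1 ⊆ quasispectrum ℂ (G.canonicalFamily.pathProd x N) := by
  classical
  intro w hw
  obtain ⟨z, rfl⟩ := exists_circle_pow_eq hpos hw
  obtain ⟨φ, hφ⟩ := exists_starAlgHom_apply_canonicalFamily_pathProd (G.pathFamily.rotate z)
  have hfixed := pathFamily_pathProd_single x N 1
  rw [hN.eq] at hfixed
  refine NonUnitalAlgHom.quasispectrum_apply_subset φ _ (spectrum_subset_quasispectrum ℂ _ ?_)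
  refine mem_spectrum_of_apply_eq_smul (v := lp.single 2 x 1) ?_ ?_
  · rw [← norm_ne_zero_iff, lp.norm_single (by norm_num), norm_one]
    exact one_ne_zero
  · rw [hφ, CuntzKriegerFamily.rotate_pathProd, _root_.smul_apply, hfixed]

theorem InfinitePath.IsExitless.not_isZornRing {x : G.InfinitePath} (hx : x.IsExitless)
    (hper : x ∈ Function.periodicPts tail) : ¬ IsZornRing G.CStar := by
  have hN := Function.isPeriodicPt_minimalPeriod tail x
  have hpos := Function.minimalPeriod_pos_of_mem_periodicPts hper
  have := G.canonicalFamily.isStarNormal_pathProd hx hN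
  refine not_isZornRing_of_corner_subset_elemental
    (u := G.canonicalFamily.pathProd x (Function.minimalPeriod tail x))
    (G.canonicalFamily.pathProd_mul_star_mul_self x _)
    (sphere_subset_quasispectrum_canonicalFamily_pathProd hpos hN) fun a => ?_
  rw [G.canonicalFamily.pathProd_mul_star_self hx]
  exact G.canonicalFamily.corner_mem_elemental hx G.canonicalFamily_generates hper a

namespace IsSimpleClosedPath

variable {n : ℕ} {μ : Fin (n + 1) → E} (hμ : G.IsSimpleClosedPath μ)

include hμ in
theorem rng_eq_src_add_one (i : Fin (n + 1)) : G.rng (μ i) = G.src (μ (i + 1)) := by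
  induction i using Fin.lastCases with
  | last => rw [Fin.last_add_one, hμ.closed]
  | cast i => rw [Fin.coeSucc_eq_succ, hμ.composable]

/-- The infinite path that winds around the closed path `μ` forever. -/
def infinitePath : G.InfinitePath where
  edge k := μ (Fin.ofNat (n + 1) k)
  composable k := by
    rw [hμ.rng_eq_src_add_one]
    congr 2
    simp [Fin.ext_iff, Fin.val_add]

theorem infinitePath_mem_periodicPts :
    hμ.infinitePath ∈ Function.periodicPts InfinitePath.tail := by
  refine Function.mk_mem_periodicPts n.succ_pos ?_
  ext k
  rw [InfinitePath.edge_iterate_tail]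
  exact congrArg μ (Fin.ext (Nat.add_mod_right k (n + 1)))

theorem isExitless_infinitePath (hexit : ¬ ∃ e, G.IsExit μ e) : hμ.infinitePath.IsExitless := by
  intro k e he
  by_contra hne
  exact hexit ⟨e, _, he, hne⟩

end IsSimpleClosedPath

end DirectedGraph

theorem proposition3 {V : Type u} {E : Type v} (G : DirectedGraph V E)
    (h : IsZornRing G.CStar) : G.ConditionL := by
  intro n μ hμ
  by_contra hexit
  exact (hμ.isExitless_infinitePath hexit).not_isZornRing hμ.infinitePath_mem_periodicPts h
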